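/- Let $d\ge 1$ be an integer. A labeled $d$-multigraph of size $n$ is a loopless graph on the vertex set $\{1,\dots,n\}$ in which every pair of distinct vertices is joined by at most $d$ indistinguishable edges. A labeled $d$-multitournament of size $n$ is a directed graph on $\{1,\dots,n\}$ in which every two distinct vertices $i,j$ are joined by exactly $d$ directed edges, namely $l$ indistinguishable edges from $i$ to $j$ and $d-l$ indistinguishable edges from $j$ to $i$ for some $0\le l\le d$ depending on the pair. It is reducible if its vertex set can be partitioned into two nonempty parts $A,B$ such that, for all $a\in A$ and $b\in B$, all $d$ edges between $a$ and $b$ go from $a$ to $b$; otherwise it is irreducible. Let $\mathfrak{it}_k(d)$ be the number of irreducible labeled $d$-multitournaments of size $k$. For a sequence $(a_n)$ and functions $f_0,f_1,\dots$ of $n$, write $a_n\approx\sum_{k\ge 0}f_k(n)$ if, as $n\to\infty$, $a_n=\sum_{k=0}^{r}f_k(n)+O(f_{r+1}(n))$ for every $r\ge 0$ and $f_{k+1}(n)=o(f_k(n))$ for every $k\ge 0$. Then, for $k\ge 1$, $\mathfrak{it}_k(d)=0$ if and only if $d=1$ and $k=2$, and the probability that a uniformly random labeled $d$-multigraph $g$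 with $n$ vertices is connected satisfies $$\mathbb P(g\text{ is connected})\approx 1-\sum_{k\ge 1}\mathfrak{it}_k(d)\binom nk\frac{(d+1)^{k(k+1)/2}}{(d+1)^{kn}},$$ where, for $d=1$, the identically zero term $k=2$ is omitted from the list of terms of the expansion (so the term $k=1$ is directly followed by the term $k=3$). -/

import Mathlib

open Asymptotics Filter

/-- A labeled `d`-multigraph of size `n`: a loopless graph on `Fin n` in which two distinct vertices
are joined by at most `d` indistinguishable edges; `mult i j` is the number of edges
between `i` and `j`. -/
@[ext]
structure DMultigraph (d n : ℕ) where
  mult : Fin n → Fin n → ℕ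
  symm : ∀ i j, mult i j = mult j i
  loopless : ∀ i, mult i i = 0
  mult_le : ∀ i j, mult i j ≤ d

/-- The simple graph obtained by forgetting multiplicities. -/
def DMultigraph.toSimpleGraph {d n : ℕ} (g : DMultigraph d n) : SimpleGraph (Fin n) where
  Adj i j := g.mult i j ≠ 0
  symm := ⟨fun i j h => by rw [g.symm j i]; exact h⟩
  loopless := ⟨fun i h => h (g.loopless i)⟩

def DMultigraph.IsConnected {d n : ℕ} (g : DMultigraph d n) : Prop :=
  g.toSimpleGraph.Connected

/-- A labeled `d`-multitournament of size `n`: `arcs i j` is the number of indistinguishable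
edges directed from `i` to `j`; two distinct vertices are joined by exactly `d` directed edges. -/
@[ext]
structure DMultitournament (d n : ℕ) where
  arcs : Fin n → Fin n → ℕ
  loopless : ∀ i, arcs i i = 0
  arcs_add : ∀ i j, i ≠ j → arcs i j + arcs j i = d

/-- The vertices split into two nonempty parts `A`, `Aᶜ` such that all the `d` edges between any
`a ∈ A` and any `b ∈ Aᶜ` are directed from `a` to `b`. -/
def DMultitournament.IsReducible {d n : ℕ} (t : DMultitournament d n) : Prop :=
  ∃ A : Set (Fin n), A.Nonempty ∧ Aᶜ.Nonempty ∧ ∀ a ∈ A, ∀ b ∈ Aᶜ, t.arcs a b = d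

def DMultitournament.IsIrreducible {d n : ℕ} (t : DMultitournament d n) : Prop :=
  ¬ t.IsReducible

instance (d n : ℕ) : Finite (DMultigraph d n) :=
  Finite.of_injective
    (fun g => (fun i j => ⟨g.mult i j, Nat.lt_succ_of_le (g.mult_le i j)⟩ :
      Fin n → Fin n → Fin (d + 1)))
    (by
      intro g h e
      ext i j
      exact congrArg Fin.val (congrFun (congrFun e i) j))

instance (d n : ℕ) : Nonempty (DMultigraph d n) :=
  ⟨⟨fun _ _ => 0, fun _ _ => rfl, fun _ => rfl, fun _ _ => Nat.zero_le _⟩⟩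

theorem DMultitournament.arcs_le {d n : ℕ} (t : DMultitournament d n) (i j : Fin n) :
    t.arcs i j ≤ d := by
  by_cases h : i = j
  · subst h
    simp [t.loopless]
  · have := t.arcs_add i j h
    omega

instance (d n : ℕ) : Finite (DMultitournament d n) :=
  Finite.of_injective
    (fun t => (fun i j => ⟨t.arcs i j, Nat.lt_succ_of_le (t.arcs_le i j)⟩ :
      Fin n → Fin n → Fin (d + 1)))
    (by
      intro g h e
      ext i j
      exact congrArg Fin.val (congrFun (congrFun e i) j))

/-- The number of irreducible `d`-multitournaments of size `k`. -/
noncomputable def numIrreducible (d k : ℕ) : ℕ :=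
  Nat.card {t : DMultitournament d k // t.IsIrreducible}

/-- The probability that a uniformly random labeled `d`-multigraph of size `n` is connected. -/
noncomputable def probConnected (d n : ℕ) : ℝ :=
  (Nat.card {g : DMultigraph d n // g.IsConnected} : ℝ) / (Nat.card (DMultigraph d n) : ℝ)

/-- The asymptotic expansion `a n ≈ ∑_{k ≥ m} f k n` as `n → ∞`. -/
def IsAsymptoticExpansion (a : ℕ → ℝ) (m : ℕ) (f : ℕ → ℕ → ℝ) : Prop :=
  (∀ r, m ≤ r → (fun n => a n - ∑ k ∈ Finset.Icc m r, f k n) =O[atTop] f (r + 1)) ∧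
  (∀ k, m ≤ k → f (k + 1) =o[atTop] f k)

/-- The terms of the expansion: `1` for `k = 0`, and
`- it_k(d) * C(n,k) * (d+1)^(k(k+1)/2) / (d+1)^(kn)` for `k ≥ 1`. -/
noncomputable def expansionTerm (d k n : ℕ) : ℝ :=
  if k = 0 then 1
  else -((numIrreducible d k : ℝ) * (n.choose k : ℝ) *
    (((d : ℝ) + 1) ^ (k * (k + 1) / 2) / ((d : ℝ) + 1) ^ (k * n)))

/-! Put q = d + 1 and g(n) = q^(n choose 2). Multigraphs and multitournaments are both colourings of
pairs by `Fin (d + 1)`, with exchange of vertices acting by `id` or `Fin.rev`, and both are counted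
by g. A cut is a vertex set whose outgoing pairs all have a fixed colour: 0 (no edge) or d (all
edges outward). Minimal nonempty cuts are the connected components, respectively the source part.

A multitournament has exactly one source part, so for exponential generating functions G = 1 + IT *
G (`total_eq_sum_numIrr`): the sequence 1, -it_1, -it_2, ... is the convolution inverse of g.

A large multigraph either has a component missing at most r vertices, necessarily unique, or splits
into two unions of components with more than r vertices each. The second kind number O(n^(r+1)
g(n-r-1)), so up to this error g is the convolution of the connected counts with g(0), ..., g(r)
(`triPow_sub_sum_numConn_isBigO`). Convolving with the inverse of g recovers the connected counts
(`isBigO_sub_sum_of_convolution_inverse`), and division by g(n) gives the expansion. Consecutive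
terms are comparable only when no coefficient vanishes, hence the separate study of it_k = 0. -/

/-- A colouring of the ordered pairs of distinct vertices; exchanging the two vertices applies `σ`
to the colour. -/
@[ext]
structure PairColoring {C : Type*} [Zero C] (σ : C → C) (V : Type*) where
  color : V → V → C
  diag : ∀ i, color i i = 0
  skew : ∀ i j, i ≠ j → color j i = σ (color i j)

namespace PairColoring

variable {C : Type*} [Zero C] {σ : C → C} {V W : Type*}

instance [Finite C] [Finite V] : Finite (PairColoring σ V) :=
  Finite.of_injective PairColoring.color fun _ _ h => PairColoring.ext h

/-- All pairs leaving `A` have colour `v`. -/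
def Cut (f : PairColoring σ V) (v : C) (A : Set V) : Prop :=
  ∀ a ∈ A, ∀ b ∈ Aᶜ, f.color a b = v

/-- Vacuous on an empty vertex set, so size 0 needs separate treatment in the counts. -/
def Irreducible (f : PairColoring σ V) (v : C) : Prop :=
  ∀ A : Set V, A.Nonempty → f.Cut v A → A = Set.univ

/-- The pullback of a colouring along an injective map. -/
def comap (f : PairColoring σ V) (e : W ↪ V) : PairColoring σ W where
  color i j := f.color (e i) (e j)
  diag _ := f.diag _
  skew _ _ h := f.skew _ _ (e.injective.ne h)

abbrev restrict (f : PairColoring σ V) (A : Set V) : PairColoring σ A :=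
  f.comap (Function.Embedding.subtype _)

def congr (e : W ≃ V) : PairColoring σ V ≃ PairColoring σ W where
  toFun f := f.comap e.toEmbedding
  invFun f := f.comap e.symm.toEmbedding
  left_inv f := by ext i j; simp [comap]
  right_inv f := by ext i j; simp [comap]

theorem Irreducible.comap {f : PairColoring σ V} {v : C} (h : f.Irreducible v) (e : W ≃ V) :
    (f.comap e.toEmbedding).Irreducible v := by
  intro A hA hc
  have := h (e '' A) (hA.image _) (by
    rintro _ ⟨a, ha, rfl⟩ b hb
    have := hc a ha (e.symm b) (fun h => hb ⟨_, h, by simp⟩)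
    simpa [PairColoring.comap] using this)
  rw [← Set.image_univ_of_surjective e.surjective] at this
  exact e.injective.image_injective this

theorem irreducible_congr (e : W ≃ V) (f : PairColoring σ V) (v : C) :
    (congr e f).Irreducible v ↔ f.Irreducible v := by
  refine ⟨fun h => ?_, fun h => h.comap e⟩
  have := h.comap e.symm
  convert this using 1
  exact ((congr e).left_inv f).symm

/-! ### Counting colourings and cuts -/

variable (σ) in
/-- The number of colourings on `n` vertices. -/
noncomputable def total (n : ℕ) : ℕ := Nat.card (PairColoring σ (Fin n))

variable (σ) in
/-- The number of irreducible colourings on `n` vertices. -/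
noncomputable def numIrr (v : C) (n : ℕ) : ℕ :=
  Nat.card {f : PairColoring σ (Fin n) // f.Irreducible v}

theorem card_eq_total [Finite V] : Nat.card (PairColoring σ V) = total σ (Nat.card V) :=
  Nat.card_congr (congr (Finite.equivFin V).symm)

theorem card_irreducible [Finite V] (v : C) :
    Nat.card {f : PairColoring σ V // f.Irreducible v} = numIrr σ v (Nat.card V) :=
  Nat.card_congr ((congr (Finite.equivFin V).symm).subtypeEquiv
    fun f => (irreducible_congr _ f v).symm)

/-- The colours of the pairs with i < j are free; involutivity of `σ` makes the reversed pairs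
consistent. -/
theorem total_eq [Fintype C] (hσ : Function.Involutive σ) (n : ℕ) :
    total σ n = Fintype.card C ^ (n * (n - 1) / 2) := by
  have e : PairColoring σ (Fin n) ≃ ((i : Fin n) → Fin i → C) :=
    { toFun := fun f i j => f.color (Fin.castLE i.2.le j) i
      invFun := fun u =>
        { color := fun i j =>
            if h : i < j then u j ⟨i, h⟩ else if h : j < i then σ (u i ⟨j, h⟩) else 0
          diag := fun i => by simp
          skew := fun i j hij => by
            rcases lt_or_gt_of_ne hij with h | h
            · simp [h, h.not_gt]
            · simp [h, h.not_gt, hσ _] }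
      left_inv := fun f => by
        ext i j
        rcases lt_trichotomy i j with h | h | h
        · simp [h]
        · subst h; simp [f.diag]
        · simp only [h.not_gt, h, dite_true, dite_false, Fin.castLE_mk, Fin.eta]
          rw [← f.skew j i h.ne]
      right_inv := fun u => by
        ext i j
        have : (Fin.castLE i.2.le j) < i := j.2
        simp [this] }
  rw [total, Nat.card_congr e, Nat.card_eq_fintype_card, Fintype.card_pi]
  simp only [Fintype.card_pi, Finset.prod_const, Finset.card_univ, Fintype.card_fin]
  rw [Finset.prod_pow_eq_pow_sum, Fin.sum_univ_eq_sum_range (fun i => i), Finset.sum_range_id]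

/-- A colouring with a cut is determined by its restrictions to both sides. -/
noncomputable def cutEquiv (hσ : Function.Involutive σ) (v : C) (A : Set V) :
    {f : PairColoring σ V // f.Cut v A} ≃ PairColoring σ A × PairColoring σ (Aᶜ : Set V) := by
  classical
  exact
  { toFun := fun f => (f.1.restrict A, f.1.restrict Aᶜ)
    invFun := fun p => ⟨
      { color := fun i j =>
          if hi : i ∈ A then (if hj : j ∈ A then p.1.color ⟨i, hi⟩ ⟨j, hj⟩ else v)
          else (if hj : j ∈ A then σ v else p.2.color ⟨i, hi⟩ ⟨j, hj⟩)
        diag := fun i => by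
          by_cases hi : i ∈ A
          · simp [hi, p.1.diag]
          · simp [hi, p.2.diag]
        skew := fun i j hij => by
          by_cases hi : i ∈ A <;> by_cases hj : j ∈ A
          · simp only [hi, hj, dite_true]
            exact p.1.skew _ _ (by simpa using hij)
          · simp [hi, hj]
          · simp [hi, hj, hσ v]
          · simp only [hi, hj, dite_false]
            exact p.2.skew _ _ (by simpa using hij) },
      fun a ha b hb => by
        have hb' : b ∉ A := hb
        simp [ha, hb']⟩
    left_inv := fun f => by
      apply Subtype.ext
      ext i j
      by_cases hi : i ∈ A <;> by_cases hj : j ∈ A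
      · simp [hi, hj, comap]
      · simp [hi, hj, f.2 i hi j hj]
      · have : i ≠ j := fun h => hi (h ▸ hj)
        simp [hi, hj, f.1.skew j i this.symm, f.2 j hj i hi]
      · simp [hi, hj, comap]
    right_inv := fun p => by
      apply Prod.ext
      · ext i j
        simp [comap]
      · ext i j
        have hi : (i : V) ∉ A := i.2
        have hj : (j : V) ∉ A := j.2
        simp [comap, hi, hj] }

theorem card_cut [Finite V] (hσ : Function.Involutive σ) (v : C) (A : Set V) :
    Nat.card {f : PairColoring σ V // f.Cut v A} = total σ A.ncard * total σ (Aᶜ).ncard := by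
  rw [Nat.card_congr (cutEquiv hσ v A), Nat.card_prod, card_eq_total, card_eq_total,
    Nat.card_coe_set_eq, Nat.card_coe_set_eq]

/-! ### Irreducible cuts: existence, uniqueness, balanced cuts -/

/-- `A` is a cut and the colouring is irreducible on `A`. -/
def IrrCut (f : PairColoring σ V) (v : C) (A : Set V) : Prop :=
  f.Cut v A ∧ (f.restrict A).Irreducible v

theorem card_irrCut [Finite V] (hσ : Function.Involutive σ) (v : C) (A : Set V) :
    Nat.card {f : PairColoring σ V // f.IrrCut v A} =
      numIrr σ v A.ncard * total σ (Aᶜ).ncard := by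
  have e : {f : PairColoring σ V // f.IrrCut v A} ≃
      {f : PairColoring σ A // f.Irreducible v} × PairColoring σ (Aᶜ : Set V) :=
    { toFun := fun f => (⟨_, f.2.2⟩, f.1.restrict Aᶜ)
      invFun := fun p =>
        ⟨(cutEquiv hσ v A).symm (p.1.1, p.2), ((cutEquiv hσ v A).symm (p.1.1, p.2)).2, by
          have h : (((cutEquiv hσ v A).symm (p.1.1, p.2)).1.restrict A) = p.1.1 :=
            congrArg Prod.fst ((cutEquiv hσ v A).apply_symm_apply (p.1.1, p.2))
          rw [h]
          exact p.1.2⟩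
      left_inv := fun f => Subtype.ext <| by
        have h : ((cutEquiv hσ v A).symm (cutEquiv hσ v A ⟨f.1, f.2.1⟩)).1 = f.1 := by
          rw [Equiv.symm_apply_apply]
        exact h
      right_inv := fun p => by
        have h : cutEquiv hσ v A ((cutEquiv hσ v A).symm (p.1.1, p.2)) = (p.1.1, p.2) :=
          (cutEquiv hσ v A).apply_symm_apply _
        have h1 := congrArg Prod.fst h
        have h2 := congrArg Prod.snd h
        exact Prod.ext (Subtype.ext h1) h2 }
  rw [Nat.card_congr e, Nat.card_prod, card_eq_total, card_irreducible,
    Nat.card_coe_set_eq, Nat.card_coe_set_eq]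

/-- The trace of `B` on `A` is a nonempty cut of the restriction to `A`, hence all of `A`. -/
theorem IrrCut.subset {f : PairColoring σ V} {v : C} {A B : Set V} (hA : f.IrrCut v A)
    (hB : f.Cut v B) (hAB : (A ∩ B).Nonempty) : A ⊆ B := by
  obtain ⟨x, hxA, hxB⟩ := hAB
  have := hA.2 {y | (y : V) ∈ B} ⟨⟨x, hxA⟩, hxB⟩ (fun a ha b hb => hB _ ha _ hb)
  intro y hy
  exact (Set.eq_univ_iff_forall.1 this) ⟨y, hy⟩

theorem IrrCut.eq {f : PairColoring σ V} {v : C} {A B : Set V} (hA : f.IrrCut v A)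
    (hB : f.IrrCut v B) (hAB : (A ∩ B).Nonempty) : A = B :=
  (hA.subset hB.1 hAB).antisymm (hB.subset hA.1 (by rwa [Set.inter_comm]))

/-- A pair leaving `B` either stays in `A` or leaves `A`, so one of the two cuts gives its colour.
-/
theorem Cut.image {f : PairColoring σ V} {v : C} {A : Set V} (hA : f.Cut v A) {B : Set A}
    (hB : (f.restrict A).Cut v B) : f.Cut v (Subtype.val '' B) := by
  rintro _ ⟨a, ha, rfl⟩ b hb
  by_cases hbA : b ∈ A
  · exact hB a ha ⟨b, hbA⟩ (fun h => hb ⟨_, h, rfl⟩)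
  · exact hA _ a.2 _ hbA

theorem Cut.compl {f : PairColoring σ V} {v : C} (hv : σ v = v) {A : Set V} (hA : f.Cut v A) :
    f.Cut v Aᶜ := by
  intro a ha b hb
  rw [compl_compl] at hb
  rw [f.skew b a (fun h => ha (h ▸ hb)), hA b hb a ha, hv]

theorem cut_univ (f : PairColoring σ V) (v : C) : f.Cut v Set.univ :=
  fun _ _ b hb => absurd (Set.mem_univ b) hb

/-- A minimal nonempty cut works, since a cut inside a cut is a cut. -/
theorem exists_irrCut [Finite V] [Nonempty V] (f : PairColoring σ V) (v : C) :
    ∃ A : Set V, A.Nonempty ∧ f.IrrCut v A := by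
  obtain ⟨A, hA⟩ := (Set.toFinite {A : Set V | A.Nonempty ∧ f.Cut v A}).exists_minimal
    ⟨Set.univ, Set.univ_nonempty, f.cut_univ v⟩
  refine ⟨A, hA.1.1, hA.1.2, fun B hB hc => ?_⟩
  have hle := hA.2 (y := Subtype.val '' B) ⟨hB.image _, hA.1.2.image hc⟩ (by simp)
  refine Set.eq_univ_of_forall fun x => ?_
  obtain ⟨y, hy, e⟩ := hle x.2
  rwa [← Subtype.ext e]

/-- Irreducible cuts that meet are equal; disjoint ones would give some pair colour `v` in both
directions, forcing `σ v = v`. -/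
theorem existsUnique_irrCut [Finite V] [Nonempty V] (f : PairColoring σ V) {v : C}
    (hv : σ v ≠ v) : ∃! A : Set V, A.Nonempty ∧ f.IrrCut v A := by
  obtain ⟨A, hne, hA⟩ := f.exists_irrCut v
  refine ⟨A, ⟨hne, hA⟩, fun B ⟨hneB, hB⟩ => hB.eq hA ?_⟩
  by_contra hem
  rw [Set.not_nonempty_iff_eq_empty] at hem
  obtain ⟨a, ha⟩ := hne
  obtain ⟨b, hb⟩ := hneB
  have hdis := Set.disjoint_iff_inter_eq_empty.2 hem
  have hbA : b ∉ A := Set.disjoint_left.1 hdis hb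
  have haB : a ∉ B := Set.disjoint_right.1 hdis ha
  have h1 := hA.1 a ha b hbA
  have h2 := hB.1 b hb a haB
  rw [f.skew a b (fun h => hbA (h ▸ ha)), h1] at h2
  exact hv h2

/-- If no irreducible cut misses at most `r` vertices, some cut has more than `r` vertices on
both sides. -/
theorem exists_balanced_cut [Finite V] (f : PairColoring σ V) {v : C} (hv : σ v = v) (r : ℕ)
    (hr : 3 * r + 1 ≤ Nat.card V)
    (h : ∀ A : Set V, f.IrrCut v A → r < (Aᶜ).ncard) :
    ∃ A : Set V, f.Cut v A ∧ r < A.ncard ∧ r < (Aᶜ).ncard := by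
  obtain ⟨A, hA⟩ := (Set.toFinite {A : Set V | r < A.ncard ∧ f.Cut v A}).exists_minimal
    ⟨Set.univ, by rw [Set.mem_ofPred_eq, Set.ncard_univ]; exact ⟨by omega, f.cut_univ v⟩⟩
  refine ⟨A, hA.1.2, hA.1.1, ?_⟩
  by_cases hi : (f.restrict A).Irreducible v
  · exact h A ⟨hA.1.2, hi⟩
  · simp only [Irreducible, not_forall] at hi
    obtain ⟨B, hB, hc, hne⟩ := hi
    -- By minimality proper cuts inside `A` have at most r vertices. As `σ v = v`, this applies to
    -- `B` and to its complement in `A`, so `A` has at most 2r vertices and misses at least r + 1.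
    have key : ∀ D : Set A, (f.restrict A).Cut v D → D ≠ Set.univ → D.ncard ≤ r := by
      intro D hD hDne
      by_contra hlt
      have hle := hA.2 (y := Subtype.val '' D)
        ⟨by rw [Set.ncard_image_of_injective _ Subtype.val_injective]; omega,
          hA.1.2.image hD⟩ (by simp)
      refine hDne (Set.eq_univ_of_forall fun x => ?_)
      obtain ⟨y, hy, e⟩ := hle x.2
      rwa [← Subtype.ext e]
    have h1 := key B hc hne
    have h2 := key Bᶜ (hc.compl hv) (by simpa using hB.ne_empty)
    have h3 := Set.ncard_add_ncard_compl B
    have h4 := Set.ncard_add_ncard_compl A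
    rw [Nat.card_coe_set_eq] at h3
    omega

/-! ### Counting colourings by their irreducible cuts -/

theorem ncard_coe_compl {n : ℕ} (A : Finset (Fin n)) :
    ((A : Set (Fin n))ᶜ).ncard = n - A.card := by
  rw [Set.ncard_compl, Set.ncard_coe_finset, Nat.card_fin]

theorem sum_filter_card {n : ℕ} (p : ℕ → Prop) [DecidablePred p] (u : ℕ → ℕ) :
    ∑ A : Finset (Fin n) with p A.card, u A.card =
      ∑ k ∈ Finset.range (n + 1) with p k, n.choose k * u k := by
  have := Finset.sum_powerset_apply_card (x := (Finset.univ : Finset (Fin n)))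
    (fun k => if p k then u k else 0)
  rw [Finset.powerset_univ, Finset.card_fin] at this
  rw [Finset.sum_filter, this, Finset.sum_filter]
  exact Finset.sum_congr rfl fun k _ => by simp

/-- Decomposition of a colouring by its unique irreducible cut. -/
theorem total_eq_sum_numIrr [Finite C] (hσ : Function.Involutive σ) {v : C} (hv : σ v ≠ v) {n : ℕ}
    (hn : 1 ≤ n) :
    total σ n = ∑ k ∈ Finset.range (n + 1) with k ≠ 0,
      n.choose k * (numIrr σ v k * total σ (n - k)) := by
  classical
  have := Fintype.ofFinite (PairColoring σ (Fin n))
  have : Nonempty (Fin n) := ⟨⟨0, hn⟩⟩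
  have hu : (Finset.univ : Finset (PairColoring σ (Fin n))) =
      (Finset.univ.filter fun A : Finset (Fin n) => A.card ≠ 0).biUnion
        fun A => Finset.univ.filter fun f => f.IrrCut v A := by
    ext f
    obtain ⟨A, hA, hc⟩ := f.exists_irrCut v
    simp only [Finset.mem_univ, Finset.mem_biUnion, Finset.mem_filter, true_and, true_iff]
    exact ⟨A.toFinite.toFinset, (Finset.card_pos.2 (by simpa using hA)).ne', by simpa using hc⟩
  rw [total, Nat.card_eq_fintype_card, ← Finset.card_univ, hu, Finset.card_biUnion,
    ← sum_filter_card]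
  · refine Finset.sum_congr rfl fun A _ => ?_
    rw [← Fintype.card_subtype, ← Nat.card_eq_fintype_card, card_irrCut hσ, ncard_coe_compl,
      Set.ncard_coe_finset]
  · intro A hA B hB hAB
    rw [Function.onFun, Finset.disjoint_filter]
    intro f _ h1 h2
    refine hAB (Finset.coe_injective ((f.existsUnique_irrCut hv).unique ⟨?_, h1⟩ ⟨?_, h2⟩))
    · simpa [Finset.nonempty_iff_ne_empty] using hA
    · simpa [Finset.nonempty_iff_ne_empty] using hB

theorem filter_range_le {n r : ℕ} (h : r ≤ n) :
    (Finset.range (n + 1)).filter (fun k => k ≤ r) = Finset.range (r + 1) := by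
  ext k; simp; omega

variable {v : C} {n r : ℕ}

/-- Two sets missing at most r of n > 2r vertices meet, so a colouring has at most one such
irreducible cut and the union is disjoint. -/
theorem card_biUnion_irrCut [Fintype (PairColoring σ (Fin n))] [DecidableEq (PairColoring σ (Fin n))]
    [∀ A : Set (Fin n), DecidablePred fun f : PairColoring σ (Fin n) => f.IrrCut v A]
    (hσ : Function.Involutive σ) (hn : 2 * r + 1 ≤ n) :
    ((Finset.univ.filter fun B : Finset (Fin n) => B.card ≤ r).biUnion
        fun B => Finset.univ.filter fun f : PairColoring σ (Fin n) =>
          f.IrrCut v (B : Set (Fin n))ᶜ).card =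
      ∑ j ∈ Finset.range (r + 1), n.choose j * (numIrr σ v (n - j) * total σ j) := by
  classical
  rw [Finset.card_biUnion, ← filter_range_le (show r ≤ n by omega), ← sum_filter_card]
  · refine Finset.sum_congr rfl fun A _ => ?_
    rw [← Fintype.card_subtype, ← Nat.card_eq_fintype_card, card_irrCut hσ, ncard_coe_compl,
      compl_compl, Set.ncard_coe_finset]
  · intro A hA B hB hAB
    rw [Function.onFun, Finset.disjoint_filter]
    intro f _ h1 h2
    refine hAB (Finset.coe_injective (compl_injective (h1.eq h2 ?_)))
    rw [← Set.compl_union, ← Finset.coe_union, Set.nonempty_compl]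
    intro h
    have h3 : (A ∪ B).card = n := by
      rw [← Set.ncard_coe_finset, h, Set.ncard_univ, Nat.card_fin]
    have h4 := Finset.card_union_le A B
    simp only [Finset.coe_filter, Finset.mem_univ, true_and, Set.mem_ofPred_eq] at hA hB
    omega

theorem sum_numIrr_le_total [Finite C] (hσ : Function.Involutive σ) (hn : 2 * r + 1 ≤ n) :
    ∑ j ∈ Finset.range (r + 1), n.choose j * (numIrr σ v (n - j) * total σ j) ≤ total σ n := by
  classical
  have := Fintype.ofFinite (PairColoring σ (Fin n))
  rw [← card_biUnion_irrCut hσ hn, total, Nat.card_eq_fintype_card]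
  exact Finset.card_le_univ _

/-- Colourings without an irreducible cut missing at most r vertices have a balanced cut; these are
overcounted by a union bound. -/
theorem total_le_sum_numIrr_add [Finite C] (hσ : Function.Involutive σ) (hv : σ v = v)
    (hn : 3 * r + 1 ≤ n) :
    total σ n ≤ ∑ j ∈ Finset.range (r + 1), n.choose j * (numIrr σ v (n - j) * total σ j) +
      ∑ s ∈ Finset.range (n + 1) with r < s ∧ r < n - s,
        n.choose s * (total σ s * total σ (n - s)) := by
  classical
  have := Fintype.ofFinite (PairColoring σ (Fin n))
  rw [← card_biUnion_irrCut (v := v) hσ (by omega), ← sum_filter_card]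
  have hsum : ∑ A : Finset (Fin n) with r < A.card ∧ r < n - A.card,
      total σ A.card * total σ (n - A.card) =
      ∑ A : Finset (Fin n) with r < A.card ∧ r < n - A.card,
        (Finset.univ.filter fun f : PairColoring σ (Fin n) => f.Cut v A).card := by
    refine Finset.sum_congr rfl fun A _ => ?_
    rw [← Fintype.card_subtype, ← Nat.card_eq_fintype_card, card_cut hσ, ncard_coe_compl,
      Set.ncard_coe_finset]
  rw [hsum, total, Nat.card_eq_fintype_card, ← Finset.card_univ]
  refine (Finset.card_le_card ?_).trans ((Finset.card_union_le _ _).trans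
    (Nat.add_le_add_left Finset.card_biUnion_le _))
  intro f _
  rw [Finset.mem_union]
  by_contra hcon
  push Not at hcon
  obtain ⟨h1, h2⟩ := hcon
  simp only [Finset.mem_biUnion, Finset.mem_filter, Finset.mem_univ, true_and, not_exists,
    not_and] at h1 h2
  obtain ⟨A, hA, hA1, hA2⟩ := f.exists_balanced_cut hv r (by simpa using hn) (by
    intro A hA
    by_contra hlt
    refine h1 (Aᶜ).toFinite.toFinset (by rw [← Set.ncard_eq_toFinset_card]; omega) ?_
    rwa [Set.Finite.coe_toFinset, compl_compl])
  have hAc := Set.ncard_add_ncard_compl A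
  rw [Nat.card_fin] at hAc
  refine h2 A.toFinite.toFinset (by rw [← Set.ncard_eq_toFinset_card]; omega) ?_
  rwa [Set.Finite.coe_toFinset]

end PairColoring

/-! ### Multigraphs and multitournaments as pair colourings -/

def DMultigraph.equivPairColoring (d n : ℕ) :
    DMultigraph d n ≃ PairColoring (id : Fin (d + 1) → Fin (d + 1)) (Fin n) where
  toFun g :=
    { color := fun i j => ⟨g.mult i j, Nat.lt_succ_of_le (g.mult_le i j)⟩
      diag := fun i => Fin.ext (g.loopless i)
      skew := fun i j _ => Fin.ext (g.symm j i) }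
  invFun f :=
    { mult := fun i j => f.color i j
      symm := fun i j => by
        rcases eq_or_ne i j with h | h
        · rw [h]
        · rw [f.skew i j h, id]
      loopless := fun i => by rw [f.diag]; rfl
      mult_le := fun i j => Nat.le_of_lt_succ (f.color i j).2 }
  left_inv _ := rfl
  right_inv _ := rfl

def DMultitournament.equivPairColoring (d n : ℕ) :
    DMultitournament d n ≃ PairColoring (Fin.rev : Fin (d + 1) → Fin (d + 1)) (Fin n) where
  toFun t :=
    { color := fun i j => ⟨t.arcs i j, Nat.lt_succ_of_le (t.arcs_le i j)⟩
      diag := fun i => Fin.ext (t.loopless i)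
      skew := fun i j h => Fin.ext (by
        have := t.arcs_add i j h
        simp only [Fin.val_rev]
        omega) }
  invFun f :=
    { arcs := fun i j => f.color i j
      loopless := fun i => by rw [f.diag]; rfl
      arcs_add := fun i j h => by
        rw [f.skew i j h, Fin.val_rev]
        have := (f.color i j).2
        omega }
  left_inv _ := rfl
  right_inv _ := rfl

theorem DMultitournament.irreducible_equivPairColoring {d n : ℕ} (t : DMultitournament d n) :
    (equivPairColoring d n t).Irreducible (Fin.last d) ↔ t.IsIrreducible := by
  simp only [PairColoring.Irreducible, IsIrreducible, IsReducible, not_exists, not_and]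
  refine forall_congr' fun A => imp_congr_right fun _ => ?_
  have : (equivPairColoring d n t).Cut (Fin.last d) A ↔ ∀ a ∈ A, ∀ b ∈ Aᶜ, t.arcs a b = d :=
    forall₂_congr fun a _ => forall₂_congr fun b _ => Fin.ext_iff
  rw [this, Set.nonempty_compl]
  tauto

/-- Size 0 is excluded because `Connected` demands a vertex. -/
theorem DMultigraph.irreducible_equivPairColoring {d n : ℕ} (hn : n ≠ 0) (g : DMultigraph d n) :
    (equivPairColoring d n g).Irreducible 0 ↔ g.IsConnected := by
  have hcut : ∀ A, (equivPairColoring d n g).Cut 0 A ↔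
      ∀ a ∈ A, ∀ b ∈ Aᶜ, ¬ g.toSimpleGraph.Adj a b := fun A =>
    forall₂_congr fun a _ => forall₂_congr fun b _ => Fin.ext_iff.trans not_not.symm
  have : Nonempty (Fin n) := ⟨⟨0, Nat.pos_of_ne_zero hn⟩⟩
  simp only [PairColoring.Irreducible, hcut, IsConnected, SimpleGraph.connected_iff, this, and_true]
  constructor
  · intro h u w
    have := h {x | g.toSimpleGraph.Reachable u x} ⟨u, SimpleGraph.Reachable.refl u⟩
      fun a ha b hb hab => hb (SimpleGraph.Reachable.trans ha hab.reachable)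
    exact Set.eq_univ_iff_forall.1 this w
  · rintro h A ⟨u, hu⟩ hA
    refine Set.eq_univ_of_forall fun w => ?_
    obtain ⟨p⟩ := h u w
    induction p with
    | nil => exact hu
    | cons hab _ ih =>
      refine ih ?_
      by_contra hb
      exact hA _ hu _ hb hab

theorem numIrreducible_eq_numIrr (d k : ℕ) :
    numIrreducible d k = PairColoring.numIrr Fin.rev (Fin.last d) k :=
  Nat.card_congr ((DMultitournament.equivPairColoring d k).subtypeEquiv
    fun t => t.irreducible_equivPairColoring.symm)

theorem probConnected_eq (d : ℕ) {n : ℕ} (hn : n ≠ 0) :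
    probConnected d n =
      PairColoring.numIrr (id : Fin (d + 1) → Fin (d + 1)) 0 n /
        PairColoring.total (id : Fin (d + 1) → Fin (d + 1)) n := by
  rw [probConnected, PairColoring.numIrr, PairColoring.total,
    Nat.card_congr (DMultigraph.equivPairColoring d n),
    Nat.card_congr ((DMultigraph.equivPairColoring d n).subtypeEquiv
      (q := fun f => f.Irreducible 0)
      fun g => (g.irreducible_equivPairColoring hn).symm)]

/-! ### Vanishing of the coefficients -/

theorem numIrreducible_ne_zero_iff (d k : ℕ) :
    numIrreducible d k ≠ 0 ↔ ∃ t : DMultitournament d k, t.IsIrreducible := by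
  rw [numIrreducible, ← Nat.pos_iff_ne_zero, Finite.card_pos_iff, nonempty_subtype]

/-- The tournament with all edges directed from `i` to `i + 1` and from `j` to `i` for
`i + 2 ≤ j`. -/
def DMultitournament.backward (d n : ℕ) : DMultitournament d n where
  arcs i j := if (j : ℕ) = i + 1 ∨ (j : ℕ) + 2 ≤ i then d else 0
  loopless i := by simp
  arcs_add i j h := by
    have : (i : ℕ) ≠ j := Fin.val_ne_of_ne h
    split_ifs <;> omega

/-- No edge goes from i + 1 to i, so the source side is closed under predecessors and contains 0.
For n ≥ 3 no edge goes from 0 to n - 1 either, so it contains the last vertex, hence everything. -/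
theorem DMultitournament.backward_isIrreducible {d n : ℕ} (hd : 1 ≤ d) (hn : n = 1 ∨ 3 ≤ n) :
    (backward d n).IsIrreducible := by
  rintro ⟨A, ⟨a, ha⟩, ⟨b, hb⟩, h⟩
  have hdown : ∀ i (hi : i < n) (hi' : i + 1 < n),
      (⟨i + 1, hi'⟩ : Fin n) ∈ A → (⟨i, hi⟩ : Fin n) ∈ A := by
    intro i hi hi' hA
    by_contra hc
    have := h _ hA _ hc
    simp only [backward] at this
    split_ifs at this <;> omega
  have hle : ∀ j (hj : j < n), (⟨j, hj⟩ : Fin n) ∈ A → ∀ i (hi : i ≤ j),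
      (⟨i, hi.trans_lt hj⟩ : Fin n) ∈ A := by
    intro j hj hA i hi
    induction j with
    | zero => obtain rfl : i = 0 := by omega
              exact hA
    | succ j ih =>
      rcases hi.eq_or_lt with rfl | hlt
      · exact hA
      · exact ih (by omega) (hdown j _ hj hA) (by omega)
  have hlast : (⟨n - 1, by omega⟩ : Fin n) ∈ A := by
    rcases hn with hn | hn
    · convert ha
      omega
    · by_contra hc
      have := h _ (hle a a.2 ha 0 (Nat.zero_le _)) _ hc
      simp only [backward] at this
      split_ifs at this <;> omega
  exact hb (hle (n - 1) _ hlast b (by omega))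

/-- The tournament with one edge from the smaller to the larger vertex of each pair. -/
def DMultitournament.oneForward {d : ℕ} (hd : 1 ≤ d) (n : ℕ) : DMultitournament d n where
  arcs i j := if i < j then 1 else if j < i then d - 1 else 0
  loopless i := by simp
  arcs_add i j h := by
    rcases lt_or_gt_of_ne h with h | h
    · simp [h, h.not_gt]; omega
    · simp [h, h.not_gt]; omega

/-- For d ≥ 2 no ordered pair carries all d edges, since 1 and d - 1 are less than d. -/
theorem DMultitournament.oneForward_isIrreducible {d : ℕ} (hd : 2 ≤ d) (n : ℕ) :
    (oneForward (by omega : 1 ≤ d) n).IsIrreducible := by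
  rintro ⟨A, ⟨a, ha⟩, ⟨b, hb⟩, h⟩
  have := h a ha b hb
  simp only [oneForward] at this
  split_ifs at this <;> omega

theorem DMultitournament.isReducible_one_two (t : DMultitournament 1 2) : t.IsReducible := by
  have h := t.arcs_add 0 1 (by decide)
  have key : ∀ a b : Fin 2, a ≠ b → t.arcs a b = 1 → t.IsReducible := by
    intro a b hab ht
    refine ⟨{a}, ⟨a, rfl⟩, ⟨b, hab.symm⟩, ?_⟩
    intro x hx y hy
    have hx : x = a := hx
    have hy : y ≠ a := hy
    have hyb : y = b := by omega
    rw [hx, hyb, ht]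
  have : t.arcs 0 1 = 1 ∨ t.arcs 1 0 = 1 := by omega
  rcases this with h | h
  · exact key 0 1 (by decide) h
  · exact key 1 0 (by decide) h

theorem numIrreducible_eq_zero_iff {d k : ℕ} (hd : 1 ≤ d) (hk : 1 ≤ k) :
    numIrreducible d k = 0 ↔ d = 1 ∧ k = 2 := by
  constructor
  · contrapose
    intro h
    rw [← ne_eq, numIrreducible_ne_zero_iff]
    rcases hd.eq_or_lt with rfl | hd'
    · exact ⟨_, DMultitournament.backward_isIrreducible (n := k) le_rfl (by omega)⟩
    · exact ⟨_, DMultitournament.oneForward_isIrreducible hd' k⟩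
  · rintro ⟨rfl, rfl⟩
    by_contra h
    obtain ⟨t, ht⟩ := (numIrreducible_ne_zero_iff 1 2).1 h
    exact ht t.isReducible_one_two

/-! ### Estimates for q^(n choose 2) -/

/-- `q ^ (n choose 2)`, the number of colourings with `q` colours. -/
def triPow (q n : ℕ) : ℕ := q ^ (n * (n - 1) / 2)

theorem triPow_succ (q n : ℕ) : triPow q (n + 1) = triPow q n * q ^ n := by
  rw [triPow, triPow, ← pow_add, ← Nat.choose_two_right, ← Nat.choose_two_right,
    Nat.choose_succ_succ' n 1, Nat.choose_one_right, add_comm]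

theorem triPow_add (q m n : ℕ) :
    triPow q (m + n) = triPow q m * triPow q n * q ^ (m * n) := by
  induction n with
  | zero => simp [triPow]
  | succ n ih =>
    rw [← add_assoc, triPow_succ, ih, triPow_succ, mul_add, pow_add, pow_add]
    ring

theorem triPow_pos {q : ℕ} (hq : 0 < q) (n : ℕ) : 0 < triPow q n := pow_pos hq _

/-- Log-convexity: an interior split loses exactly q^(ab) against the extreme split with parts m and
m + a + b. -/
theorem triPow_mul_triPow (q m a b : ℕ) :
    triPow q (m + a) * triPow q (m + b) * q ^ (a * b) =
      triPow q m * triPow q (m + (a + b)) := by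
  rw [triPow_add, triPow_add q m b, triPow_add q m (a + b), triPow_add q a b, mul_add, pow_add]
  ring

/-- Pairs of colourings of sizes `s` and `n - s` with `m ≤ s ≤ n - m` are dominated by the
extreme cases. -/
theorem sum_choose_mul_triPow_le {q m n : ℕ} (hq : 2 ≤ q) (hn : 2 * m + 1 ≤ n) :
    (∑ s ∈ Finset.range (n + 1) with m ≤ s ∧ m ≤ n - s,
        (n.choose s : ℝ) * (triPow q s * triPow q (n - s)) : ℝ) ≤
      (triPow q m * (2 + (q : ℝ) ^ (2 * m + 1))) * ((n : ℝ) ^ m * triPow q (n - m)) := by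
  -- `Y` bounds each of the extreme terms s = m and s = n - m; `X / 2 ^ n` bounds every interior
  -- product, so that the binomial sum 2^n cancels.
  set Y : ℝ := (n : ℝ) ^ m * (triPow q m * triPow q (n - m)) with hY
  set X : ℝ := (q : ℝ) ^ (2 * m + 1) * (triPow q m * triPow q (n - m)) with hX
  have hY0 : 0 ≤ Y := by positivity
  have hX0 : 0 ≤ X := by positivity
  have hterm : ∀ s ∈ (Finset.range (n + 1)).filter (fun s => m ≤ s ∧ m ≤ n - s),
      (n.choose s : ℝ) * (triPow q s * triPow q (n - s)) ≤
        (if s = m then Y else 0) + (if s = n - m then Y else 0) +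
          (n.choose s : ℝ) * (X / 2 ^ n) := by
    intro s hs
    simp only [Finset.mem_filter, Finset.mem_range] at hs
    obtain ⟨hsn, hms, hmt⟩ := hs
    have hlast : 0 ≤ (n.choose s : ℝ) * (X / 2 ^ n) := by positivity
    have hchoose : (n.choose m : ℝ) ≤ (n : ℝ) ^ m := by exact_mod_cast Nat.choose_le_pow n m
    by_cases h1 : s = m
    · have : (n.choose s : ℝ) * (triPow q s * triPow q (n - s)) ≤ Y := by
        rw [h1, hY]
        gcongr
      rw [if_pos h1]
      have : (0 : ℝ) ≤ if s = n - m then Y else 0 := by split_ifs <;> simp [hY0]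
      linarith
    by_cases h2 : s = n - m
    · have : (n.choose s : ℝ) * (triPow q s * triPow q (n - s)) ≤ Y := by
        rw [h2, hY, Nat.choose_symm (by omega), Nat.sub_sub_self (by omega),
          mul_comm (triPow q (n - m) : ℝ)]
        gcongr
      rw [if_pos h2, if_neg h1]
      linarith
    rw [if_neg h1, if_neg h2, zero_add, zero_add]
    refine mul_le_mul_of_nonneg_left ?_ (Nat.cast_nonneg _)
    rw [le_div_iff₀ (by positivity)]
    obtain ⟨a, rfl⟩ : ∃ a, s = m + (a + 1) := ⟨s - m - 1, by omega⟩
    obtain ⟨b, rfl⟩ : ∃ b, n = m + (a + 1) + (m + (b + 1)) :=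
      ⟨n - (m + (a + 1)) - m - 1, by omega⟩
    have key := triPow_mul_triPow q m (a + 1) (b + 1)
    have e1 : m + (a + 1) + (m + (b + 1)) - (m + (a + 1)) = m + (b + 1) := by omega
    have e2 : m + (a + 1) + (m + (b + 1)) - m = m + (a + 1 + (b + 1)) := by omega
    rw [hX, e1, e2]
    -- Here (a+1)(b+1) ≥ a+b+1 = n - (2m+1), so the convexity gain times q^(2m+1) is at least q^n ≥
    -- 2^n.
    have hnat : triPow q (m + (a + 1)) * triPow q (m + (b + 1)) *
        2 ^ (m + (a + 1) + (m + (b + 1))) ≤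
        q ^ (2 * m + 1) * (triPow q m * triPow q (m + (a + 1 + (b + 1)))) := by
      rw [← key]
      calc _ ≤ triPow q (m + (a + 1)) * triPow q (m + (b + 1)) *
            q ^ (m + (a + 1) + (m + (b + 1))) := by gcongr
        _ ≤ triPow q (m + (a + 1)) * triPow q (m + (b + 1)) *
            q ^ ((2 * m + 1) + (a + 1) * (b + 1)) := by
          refine Nat.mul_le_mul_left _ (Nat.pow_le_pow_right (by omega) ?_)
          nlinarith
        _ = _ := by rw [pow_add]; ring
    exact_mod_cast hnat
  refine (Finset.sum_le_sum hterm).trans ?_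
  refine (Finset.sum_le_sum_of_subset_of_nonneg (Finset.filter_subset _ _) ?_).trans ?_
  · intro s _ _
    have h1 : (0 : ℝ) ≤ if s = n - m then Y else 0 := by split_ifs <;> simp [hY0]
    have h2 : (0 : ℝ) ≤ if s = m then Y else 0 := by split_ifs <;> simp [hY0]
    positivity
  · have hsum : (∑ s ∈ Finset.range (n + 1), (n.choose s : ℝ)) = 2 ^ n := by
      exact_mod_cast Nat.sum_range_choose n
    rw [Finset.sum_add_distrib, Finset.sum_add_distrib, Finset.sum_ite_eq', Finset.sum_ite_eq',
      ← Finset.sum_mul, hsum, mul_div_cancel₀ _ (by positivity : (2 : ℝ) ^ n ≠ 0),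
      if_pos (by simp; omega), if_pos (by simp)]
    have hn1 : (1 : ℝ) ≤ (n : ℝ) ^ m := one_le_pow₀ (by exact_mod_cast (by omega : 1 ≤ n))
    have : X ≤ (q : ℝ) ^ (2 * m + 1) * Y := by
      rw [hX, hY]
      refine mul_le_mul_of_nonneg_left ?_ (by positivity)
      exact le_mul_of_one_le_left (by positivity) hn1
    calc Y + Y + X ≤ Y + Y + (q : ℝ) ^ (2 * m + 1) * Y := by gcongr
      _ = _ := by rw [hY]; ring

/-! ### Inverting the convolution -/

/-- If `g n` is, up to a small error, a binomial convolution of `c` with the first terms of `g`,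
then `c n` is, up to the same error, a convolution of `g` with the first terms of the
convolution inverse `h` of `g`. -/
theorem isBigO_sub_sum_of_convolution_inverse {g c h : ℕ → ℝ}
    (hconv : ∀ m, ∑ k ∈ Finset.range (m + 1), (m.choose k : ℝ) * (h k * g (m - k)) =
      if m = 0 then 1 else 0)
    (hg : ∀ r, (fun n => g n - ∑ j ∈ Finset.range (r + 1), (n.choose j : ℝ) * (c (n - j) * g j))
      =O[atTop] fun n => (n : ℝ) ^ (r + 1) * g (n - (r + 1))) (r : ℕ) :
    (fun n => c n - ∑ k ∈ Finset.range (r + 1), (n.choose k : ℝ) * (h k * g (n - k)))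
      =O[atTop] fun n => (n : ℝ) ^ (r + 1) * g (n - (r + 1)) := by
  have hid : ∀ᶠ n in atTop,
      -∑ k ∈ Finset.range (r + 1), (n.choose k : ℝ) * h k *
        (g (n - k) - ∑ j ∈ Finset.range (r - k + 1),
          ((n - k).choose j : ℝ) * (c (n - k - j) * g j)) =
      c n - ∑ k ∈ Finset.range (r + 1), (n.choose k : ℝ) * (h k * g (n - k)) := by
    filter_upwards [eventually_ge_atTop r] with n hn
    -- The inserted inner sum is the convolution identity, which kills every term but m = 0; the
    -- double sum is then reordered by k and j = m - k.
    have hc : c n = ∑ m ∈ Finset.range (r + 1), (n.choose m : ℝ) * c (n - m) *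
        ∑ k ∈ Finset.range (m + 1), (m.choose k : ℝ) * (h k * g (m - k)) := by
      simp only [hconv, mul_ite, mul_one, mul_zero]
      simp
    have hflip := Finset.sum_range_diag_flip (r + 1) fun k j =>
      (n.choose k : ℝ) * h k * (((n - k).choose j : ℝ) * (c (n - k - j) * g j))
    have hc' : c n = ∑ k ∈ Finset.range (r + 1), (n.choose k : ℝ) * h k *
        ∑ j ∈ Finset.range (r - k + 1), ((n - k).choose j : ℝ) * (c (n - k - j) * g j) := by
      rw [hc]
      refine Eq.trans ?_ (hflip.trans ?_)
      · refine Finset.sum_congr rfl fun m hm => ?_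
        rw [Finset.mul_sum]
        refine Finset.sum_congr rfl fun k hk => ?_
        have hkm : k ≤ m := by simpa [Nat.lt_succ_iff] using hk
        have hch : (n.choose m : ℝ) * m.choose k = n.choose k * (n - k).choose (m - k) := by
          exact_mod_cast Nat.choose_mul (n := n) hkm
        have e : n - k - (m - k) = n - m := by omega
        rw [e]
        linear_combination (c (n - m) * h k * g (m - k)) * hch
      · refine Finset.sum_congr rfl fun k hk => ?_
        have hkr : r + 1 - k = r - k + 1 := by
          have := Finset.mem_range.1 hk
          omega
        rw [Finset.mul_sum, hkr]
    conv_rhs => rw [hc']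
    rw [← Finset.sum_neg_distrib, ← Finset.sum_sub_distrib]
    exact Finset.sum_congr rfl fun k _ => by ring
  refine IsBigO.congr' ?_ hid EventuallyEq.rfl
  refine IsBigO.neg_left (IsBigO.fun_sum fun k hk => ?_)
  have hkr : k ≤ r := by
    have := Finset.mem_range.1 hk
    omega
  -- Truncating at order r - k for size n - k makes every error involve the same g(n - (r+1)), with
  -- n^k from the binomial completing the power n^(r+1).
  have h1 := (hg (r - k)).comp_tendsto (tendsto_sub_atTop_nat k)
  have h2 : (fun n : ℕ => (n.choose k : ℝ) * h k) =O[atTop] fun n => (n : ℝ) ^ k := by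
    refine IsBigO.of_bound |h k| (Eventually.of_forall fun n => ?_)
    rw [norm_mul, mul_comm, Real.norm_eq_abs (h k)]
    refine mul_le_mul_of_nonneg_left ?_ (abs_nonneg _)
    rw [Real.norm_of_nonneg (by positivity), Real.norm_of_nonneg (by positivity)]
    exact_mod_cast Nat.choose_le_pow n k
  refine (h2.mul h1).trans (IsBigO.of_bound 1 (Eventually.of_forall fun n => ?_))
  have e : n - k - (r - k + 1) = n - (r + 1) := by omega
  simp only [Function.comp_apply]
  rw [e, one_mul, ← mul_assoc, norm_mul, norm_mul _ (g _)]
  refine mul_le_mul_of_nonneg_right ?_ (norm_nonneg _)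
  rw [Real.norm_of_nonneg (by positivity), Real.norm_of_nonneg (by positivity)]
  calc (n : ℝ) ^ k * ((n - k : ℕ) : ℝ) ^ (r - k + 1) ≤ (n : ℝ) ^ k * (n : ℝ) ^ (r - k + 1) := by
        gcongr
        exact Nat.sub_le _ _
    _ = (n : ℝ) ^ (r + 1) := by rw [← pow_add]; congr 1; omega

/-! ### The expansion of the connectedness probability -/

/-- The signed coefficients `1, -it₁, -it₂, …` of the expansion. -/
noncomputable def expansionCoeff (d k : ℕ) : ℝ :=
  if k = 0 then 1 else -(numIrreducible d k : ℝ)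

theorem total_eq_triPow (d n : ℕ) {σ : Fin (d + 1) → Fin (d + 1)} (hσ : Function.Involutive σ) :
    PairColoring.total σ n = triPow (d + 1) n := by
  rw [PairColoring.total_eq hσ, Fintype.card_fin, triPow]

/-- This is the source-part decomposition with the k = 0 term moved across; d ≥ 1 ensures that 0 and
d are different colours. -/
theorem sum_expansionCoeff_mul {d : ℕ} (hd : 1 ≤ d) (m : ℕ) :
    ∑ k ∈ Finset.range (m + 1),
      (m.choose k : ℝ) * (expansionCoeff d k * triPow (d + 1) (m - k)) =
        if m = 0 then 1 else 0 := by
  split_ifs with hm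
  · subst hm
    simp [expansionCoeff, triPow]
  · have hv : Fin.rev (Fin.last d) ≠ Fin.last d := by
      rw [Fin.rev_last]
      intro h
      have := congrArg Fin.val h
      simp at this
      omega
    have h := PairColoring.total_eq_sum_numIrr Fin.rev_involutive hv (Nat.one_le_iff_ne_zero.2 hm)
    simp only [total_eq_triPow d _ Fin.rev_involutive, ← numIrreducible_eq_numIrr] at h
    rw [Finset.sum_filter, Finset.sum_range_succ'] at h
    rw [Finset.sum_range_succ']
    have h' : (triPow (d + 1) m : ℝ) = ∑ k ∈ Finset.range m, (m.choose (k + 1) : ℝ) *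
        ((numIrreducible d (k + 1) : ℝ) * triPow (d + 1) (m - (k + 1))) := by
      exact_mod_cast (by simpa using h)
    simp only [expansionCoeff, Nat.succ_ne_zero, if_false, if_true, neg_mul, mul_neg,
      Finset.sum_neg_distrib]
    rw [← h']
    simp

/-- The number of connected multigraphs, in terms of colourings. -/
noncomputable def numConn (d n : ℕ) : ℕ :=
  PairColoring.numIrr (id : Fin (d + 1) → Fin (d + 1)) 0 n

theorem triPow_sub_sum_numConn_isBigO {d : ℕ} (hd : 1 ≤ d) (r : ℕ) :
    (fun n => (triPow (d + 1) n : ℝ) - ∑ j ∈ Finset.range (r + 1),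
        (n.choose j : ℝ) * (numConn d (n - j) * triPow (d + 1) j))
      =O[atTop] fun n => (n : ℝ) ^ (r + 1) * (triPow (d + 1) (n - (r + 1)) : ℝ) := by
  refine IsBigO.of_bound
    (triPow (d + 1) (r + 1) * (2 + ((d + 1 : ℕ) : ℝ) ^ (2 * (r + 1) + 1))) ?_
  filter_upwards [eventually_ge_atTop (3 * r + 3)] with n hn
  have hid : Function.Involutive (id : Fin (d + 1) → Fin (d + 1)) := fun _ => rfl
  have h1 := PairColoring.sum_numIrr_le_total (v := 0) hid (by omega : 2 * r + 1 ≤ n)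
  have h2 := PairColoring.total_le_sum_numIrr_add (v := 0) hid rfl (by omega : 3 * r + 1 ≤ n)
  simp only [total_eq_triPow d _ hid] at h1 h2
  have h1' : ∑ j ∈ Finset.range (r + 1),
      (n.choose j : ℝ) * (numConn d (n - j) * triPow (d + 1) j) ≤ triPow (d + 1) n := by
    exact_mod_cast h1
  have h2' : (triPow (d + 1) n : ℝ) ≤ ∑ j ∈ Finset.range (r + 1),
      (n.choose j : ℝ) * (numConn d (n - j) * triPow (d + 1) j) +
      ∑ s ∈ Finset.range (n + 1) with r + 1 ≤ s ∧ r + 1 ≤ n - s,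
        (n.choose s : ℝ) * (triPow (d + 1) s * triPow (d + 1) (n - s)) := by
    exact_mod_cast h2
  have h3 := sum_choose_mul_triPow_le (q := d + 1) (m := r + 1) (n := n) (by omega) (by omega)
  rw [Real.norm_of_nonneg (by linarith), Real.norm_of_nonneg (by positivity)]
  linarith

theorem expansionTerm_eq {d k n : ℕ} (hk : k ≤ n) :
    expansionTerm d k n =
      (n.choose k : ℝ) * (expansionCoeff d k * triPow (d + 1) (n - k)) / triPow (d + 1) n := by
  have hpos : (0 : ℝ) < triPow (d + 1) n := by exact_mod_cast triPow_pos (Nat.succ_pos d) n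
  rw [expansionTerm, expansionCoeff]
  split_ifs with h
  · subst h
    simp [hpos.ne']
  · have hnat : triPow (d + 1) n * (d + 1) ^ (k * (k + 1) / 2) =
        triPow (d + 1) (n - k) * (d + 1) ^ (k * n) := by
      obtain ⟨m, rfl⟩ := Nat.exists_eq_add_of_le hk
      -- The identity C(k,2) + C(k+1,2) = k^2 turns q^(k(n-k)) into q^(kn).
      have hkk : k * (k - 1) / 2 + k * (k + 1) / 2 = k * k := by
        have := Nat.choose_two_right (k + 1)
        rw [Nat.choose_succ_succ' k 1, Nat.choose_one_right, Nat.choose_two_right,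
          Nat.add_sub_cancel, mul_comm (k + 1)] at this
        have h3 : k * (k - 1) / 2 * 2 = k * (k - 1) :=
          Nat.div_mul_cancel (Nat.even_mul_pred_self k).two_dvd
        have h4 : k * (k - 1) + k = k * k := by
          obtain ⟨j, rfl⟩ := Nat.exists_eq_succ_of_ne_zero h
          simp; ring
        omega
      rw [triPow_add, Nat.add_sub_cancel_left, mul_add k k m, pow_add, ← hkk, pow_add, triPow]
      ring
    have hreal : (triPow (d + 1) n : ℝ) * ((d : ℝ) + 1) ^ (k * (k + 1) / 2) =
        triPow (d + 1) (n - k) * ((d : ℝ) + 1) ^ (k * n) := by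
      exact_mod_cast hnat
    have hd0 : ((d : ℝ) + 1) ^ (k * n) ≠ 0 := by positivity
    rw [eq_div_iff hpos.ne', div_eq_mul_inv]
    field_simp
    linear_combination (-(numIrreducible d k : ℝ) * n.choose k) * hreal

/-- The order of magnitude of the `k`-th term of the expansion. -/
noncomputable def expansionScale (d k n : ℕ) : ℝ := (n / ((d : ℝ) + 1) ^ n) ^ k

theorem expansionScale_isLittleO {d k l : ℕ} (hd : 1 ≤ d) (hkl : k < l) :
    expansionScale d l =o[atTop] expansionScale d k := by
  have h : Tendsto (fun n : ℕ => (n : ℝ) / ((d : ℝ) + 1) ^ n) atTop (nhds 0) := by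
    have := tendsto_pow_const_div_const_pow_of_one_lt 1
      (show (1 : ℝ) < d + 1 by have : (1 : ℝ) ≤ d := by exact_mod_cast hd
                               linarith)
    simpa using this
  exact (isLittleO_pow_pow hkl).comp_tendsto h

theorem expansionTerm_isTheta {d k : ℕ} (hk : expansionCoeff d k ≠ 0) :
    expansionTerm d k =Θ[atTop] expansionScale d k := by
  have hq : (0 : ℝ) < (d : ℝ) + 1 := by positivity
  set K : ℝ := expansionCoeff d k * ((d : ℝ) + 1) ^ (k * (k + 1) / 2)
  have hK : K ≠ 0 := mul_ne_zero hk (by positivity)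
  have e1 : expansionTerm d k = fun n : ℕ => K * ((n.choose k : ℝ) * (((d : ℝ) + 1) ^ (k * n))⁻¹) := by
    ext n
    simp only [expansionTerm, K, expansionCoeff]
    split_ifs with h
    · simp [h]
    · rw [div_eq_mul_inv]
      ring
  have e2 : expansionScale d k = fun n : ℕ => (n : ℝ) ^ k * (((d : ℝ) + 1) ^ (k * n))⁻¹ := by
    ext n
    rw [expansionScale, div_pow, ← pow_mul, mul_comm n k, div_eq_mul_inv]
  rw [e1, e2, isTheta_const_mul_left hK]
  exact (isTheta_choose k).mul (isTheta_refl _ _)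

theorem probConnected_sub_sum_isBigO {d : ℕ} (hd : 1 ≤ d) (r : ℕ) :
    (fun n => probConnected d n - ∑ k ∈ Finset.range (r + 1), expansionTerm d k n)
      =O[atTop] expansionScale d (r + 1) := by
  have h := isBigO_sub_sum_of_convolution_inverse
    (g := fun n => (triPow (d + 1) n : ℝ)) (c := fun n => (numConn d n : ℝ))
    (sum_expansionCoeff_mul hd) (triPow_sub_sum_numConn_isBigO hd) r
  have h' := h.mul (isBigO_refl (fun n => ((triPow (d + 1) n : ℝ))⁻¹) atTop)
  have hl : (fun n => ((numConn d n : ℝ) - ∑ k ∈ Finset.range (r + 1), (n.choose k : ℝ) *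
      (expansionCoeff d k * triPow (d + 1) (n - k))) * ((triPow (d + 1) n : ℝ))⁻¹) =ᶠ[atTop]
      fun n => probConnected d n - ∑ k ∈ Finset.range (r + 1), expansionTerm d k n := by
    filter_upwards [eventually_ge_atTop (r + 1)] with n hn
    rw [probConnected_eq d (by omega), total_eq_triPow d n (fun _ => rfl), sub_mul,
      Finset.sum_mul, ← div_eq_mul_inv]
    refine congrArg₂ _ rfl (Finset.sum_congr rfl fun k hk => ?_)
    have := Finset.mem_range.1 hk
    rw [expansionTerm_eq (by omega), div_eq_mul_inv]
  refine (h'.congr' hl EventuallyEq.rfl).trans ?_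
  -- With n = r + 1 + m, the constant is the quotient of q^((r+1)n) by q^((r+1)m).
  refine IsBigO.of_bound (((d : ℝ) + 1) ^ ((r + 1) * (r + 1))) ?_
  filter_upwards [eventually_ge_atTop (r + 1)] with n hn
  obtain ⟨m, rfl⟩ := Nat.exists_eq_add_of_le hn
  have ha : (1 : ℝ) ≤ triPow (d + 1) (r + 1) := by
    exact_mod_cast triPow_pos (Nat.succ_pos d) (r + 1)
  have hm : (0 : ℝ) < triPow (d + 1) m := by exact_mod_cast triPow_pos (Nat.succ_pos d) m
  rw [Real.norm_of_nonneg (by positivity), expansionScale, Real.norm_of_nonneg (by positivity),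
    Nat.add_sub_cancel_left, triPow_add, div_pow, ← pow_mul, mul_assoc, mul_comm (_ ^ _) (_ / _),
    div_mul_eq_mul_div, mul_div_assoc]
  refine mul_le_mul_of_nonneg_left ?_ (by positivity)
  rw [← div_eq_mul_inv, div_le_div_iff₀ (by push_cast; positivity) (by positivity)]
  push_cast
  rw [add_mul, pow_add, mul_comm m]
  have hx : 0 ≤ (triPow (d + 1) m : ℝ) *
      (((d : ℝ) + 1) ^ ((r + 1) * (r + 1)) * ((d : ℝ) + 1) ^ ((r + 1) * m)) := by positivity
  linarith [le_mul_of_one_le_left hx ha]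

/-- Reindexing the expansion by a sequence of indices that skips only zero terms. -/
theorem isAsymptoticExpansion_probConnected {d : ℕ} (hd : 1 ≤ d) {κ : ℕ → ℕ}
    (hκ : ∀ j, κ j < κ (j + 1)) (hne : ∀ j, expansionCoeff d (κ j) ≠ 0)
    (hsum : ∀ r n, ∑ j ∈ Finset.Icc 0 r, expansionTerm d (κ j) n =
      ∑ k ∈ Finset.range (κ (r + 1)), expansionTerm d k n) :
    IsAsymptoticExpansion (probConnected d) 0 (fun j => expansionTerm d (κ j)) := by
  refine ⟨fun r _ => ?_, fun k _ => ?_⟩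
  · simp only [hsum]
    -- The full partial sum stops just before `κ (r + 1)`, so its error already has the scale of the
    -- next retained term, even across a skipped index.
    obtain ⟨s, hs⟩ := Nat.exists_eq_succ_of_ne_zero (Nat.ne_zero_of_lt (hκ r))
    refine IsBigO.trans ?_ (expansionTerm_isTheta (hne (r + 1))).isBigO_symm
    rw [hs]
    exact probConnected_sub_sum_isBigO hd s
  · exact ((expansionTerm_isTheta (hne (k + 1))).trans_isLittleO
      (expansionScale_isLittleO hd (hκ k))).trans_isTheta (expansionTerm_isTheta (hne k)).symm

theorem expansionCoeff_ne_zero {d k : ℕ} (hd : 1 ≤ d) (hk : ¬ (d = 1 ∧ k = 2)) :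
    expansionCoeff d k ≠ 0 := by
  rw [expansionCoeff]
  split_ifs with h
  · exact one_ne_zero
  · rw [neg_ne_zero, Nat.cast_ne_zero, ne_eq,
      numIrreducible_eq_zero_iff hd (Nat.one_le_iff_ne_zero.2 h)]
    exact hk

theorem mainTheorem3 (d : ℕ) (hd : 1 ≤ d) :
    (∀ k, 1 ≤ k → (numIrreducible d k = 0 ↔ d = 1 ∧ k = 2)) ∧
    (2 ≤ d → IsAsymptoticExpansion (probConnected d) 0 (expansionTerm d)) ∧
    (d = 1 → IsAsymptoticExpansion (probConnected d) 0
      (fun j => expansionTerm d (if j < 2 then j else j + 1))) := by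
  refine ⟨fun k hk => numIrreducible_eq_zero_iff hd hk, fun hd2 => ?_, fun hd1 => ?_⟩
  · refine isAsymptoticExpansion_probConnected hd (κ := id) (fun j => Nat.lt_succ_self j)
      (fun j => expansionCoeff_ne_zero hd (by omega)) fun r n => ?_
    rw [← Nat.range_succ_eq_Icc_zero]
    rfl
  · refine isAsymptoticExpansion_probConnected hd (κ := fun j => if j < 2 then j else j + 1)
      (fun j => by split_ifs <;> omega)
      (fun j => expansionCoeff_ne_zero hd (by split_ifs <;> omega)) fun r n => ?_
    rw [← Nat.range_succ_eq_Icc_zero]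
    have h2 : expansionTerm d 2 n = 0 := by
      rw [expansionTerm, (numIrreducible_eq_zero_iff hd (by norm_num)).2 ⟨hd1, rfl⟩]
      simp
    induction r with
    | zero => simp
    | succ r ih =>
      rw [Finset.sum_range_succ, ih]
      -- Only at r = 0 does the upper index jump by two, from 1 to 3, picking up the zero term of
      -- index 2.
      rcases Nat.eq_zero_or_pos r with rfl | hr
      · simp [Finset.sum_range_succ, h2]
      · rw [if_neg (by omega), if_neg (by omega), Finset.sum_range_succ _ (r + 1 + 1)]
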